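/- **Setting.** A *basic chain Datalog program* $\Pi$ is a finite set of chain rules $P(x,y) \text{ :- } Q_0(x,z_1)\wedge Q_1(z_1,z_2)\wedge\cdots\wedge Q_k(z_k,y)$ ($k\ge 0$; $x,y,z_i$ distinct variables; $P$ an IDB predicate, each $Q_i$ an EDB or IDB predicate; finitely many EDB predicates), with a target IDB predicate $T$. Ignoring the variables turns $\Pi$ into a context-free grammar (EDB predicates are terminals, IDB predicates nonterminals, $T$ is the start symbol) that generates a language $L$ over the EDB predicates. $\mathsf{TC}$ is the program $T(x,y)\text{ :- }E(x,y)$; $T(x,y)\text{ :- }T(x,z)\wedge E(z,y)$. An input $I$ is a finite set of EDB facts; $m=|I|$ is its number of facts and $n$ the number of constants in it. The *provenance polynomial* $p^I_\Pi(\alpha)$ of a fact $\alpha=T(s,t)$ is the sum, over all tight proof trees of $\alpha$ (no two internal nodes on a common leaf-to-root path carry the same fact), of the product of the variables $x_f$, $f\in I$, of the leaves. A semiring is commutative; it is *absorptive* if $\mathbf 1\oplus x=\mathbf 1$ for all $x$. A *circuit* is a DAG whose inputs are variables $x_f$, $f\in I$, and constants $\mathbf 0,\mathbf 1$, whose other gates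 are $\oplus$- and $\otimes$-gates of fan-in two, with one designated output gate; its size is the number of gates and its depth the length of a longest path from an input to the output. It *computes* $p$ over $\mathbb S$ if the polynomial it produces and $p$ define the same function over $\mathbb S$. Let $\mathrm{size}_{\Pi,\mathbb S}(m,n)$ (resp. $\mathrm{depth}_{\Pi,\mathbb S}(m,n)$) be the maximum, over all inputs $I$ with at most $m$ facts and at most $n$ constants and over all facts $T(s,t)$, of the minimum size (resp. depth) of a circuit computing $p^I_\Pi(T(s,t))$ over $\mathbb S$. **Theorem.** Let $\Pi$ be a basic chain Datalog program whose language $L$ is regular and infinite. Then the provenance polynomial for $\Pi$ has the same circuit size and depth complexity as $\mathsf{TC}$ over any absorptive semiring, in the following sense. There is a constant $c$, depending only on $\Pi$, such that, for $(A,B)=(\mathsf{TC},\Pi)$ and for $(A,B)=(\Pi,\mathsf{TC})$: 1. (size- and depth-preserving circuit reduction) for every input $I$ of $A$ with $m$ facts and $n$ constants, and every fact $T(s,t)$, there are an input $I'$ of $B$ with at most $c(m+1)$ facts and at most $c(n+1)$ constants, and a target fact $T'(s',t')$ of $B$, such that for every circuit $F'$ over the variables of $I'$ there is a circuit $F$ over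 the variables of $I$ with $|F|\le|F'|$ and $\mathrm{depth}(F)\le\mathrm{depth}(F')$ with the property that, for every absorptive semiring $\mathbb S$, if $F'$ computes $p^{I'}_B(T'(s',t'))$ over $\mathbb S$, then $F$ computes $p^I_A(T(s,t))$ over $\mathbb S$; 2. consequently, for every absorptive semiring $\mathbb S$ and all $m,n\ge 0$, $$\mathrm{size}_{A,\mathbb S}(m,n)\le \mathrm{size}_{B,\mathbb S}\bigl(c(m+1),c(n+1)\bigr),\qquad \mathrm{depth}_{A,\mathbb S}(m,n)\le \mathrm{depth}_{B,\mathbb S}\bigl(c(m+1),c(n+1)\bigr).$$ -/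

import Mathlib

universe u v w

namespace ChainDatalog

/-! ### Programs -/

/-- A chain rule `P(x, y) :- Q₀(x, z₁) ∧ Q₁(z₁, z₂) ∧ ⋯ ∧ Qₖ(zₖ, y)` over binary predicates, with
`x, y, z₁, …, zₖ` distinct variables. It is determined, up to the names of the variables, by the
predicate `P` of its head and the non-empty list `Q₀, …, Qₖ` of the predicates of its body; an EDB
predicate is a `Symbol.terminal`, an IDB predicate a `Symbol.nonterminal`. -/
structure ChainRule (EDB : Type v) (IDB : Type) where
  head : IDB
  body : List (Symbol EDB IDB)
  body_ne_nil : body ≠ []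

/-- The production obtained from a chain rule by ignoring the variables. -/
def ChainRule.toProduction {EDB : Type v} {IDB : Type} (r : ChainRule EDB IDB) :
    ContextFreeRule EDB IDB :=
  ⟨r.head, r.body⟩

theorem ChainRule.toProduction_injective {EDB : Type v} {IDB : Type} :
    Function.Injective (ChainRule.toProduction : ChainRule EDB IDB → ContextFreeRule EDB IDB) := by
  rintro ⟨h, b, hb⟩ ⟨h', b', hb'⟩ e
  simp only [ChainRule.toProduction, ContextFreeRule.mk.injEq] at e
  obtain ⟨rfl, rfl⟩ := e
  rfl

/-- A basic chain Datalog program: finitely many chain rules and a target IDB predicate. -/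
structure Program (EDB : Type v) (IDB : Type) where
  rules : Finset (ChainRule EDB IDB)
  target : IDB

/-- The context-free grammar that corresponds to a basic chain Datalog program. -/
def Program.grammar {EDB : Type v} {IDB : Type} (P : Program EDB IDB) :
    ContextFreeGrammar EDB where
  NT := IDB
  initial := P.target
  rules := P.rules.map ⟨ChainRule.toProduction, ChainRule.toProduction_injective⟩

/-- Transitive closure: `T(x, y) :- E(x, y)` and `T(x, y) :- T(x, z) ∧ E(z, y)`. -/
def transitiveClosure : Program Unit Unit where
  rules := Finset.cons
    ⟨(), [Symbol.terminal ()], by simp⟩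
    {⟨(), [Symbol.nonterminal (), Symbol.terminal ()], by simp⟩}
    (by simp)
  target := ()

/-! ### Inputs, groundings, proof trees -/

/-- The fact `R(a, b)` is the triple `(R, a, b)`. -/
abbrev Fact (Rel : Type*) (V : Type) := Rel × V × V

/-- The active domain of an input database: all constants occurring in it. -/
def activeDomain {EDB : Type v} {V : Type} (I : Finset (Fact EDB V)) : Set V :=
  {a | ∃ f ∈ I, a = f.2.1 ∨ a = f.2.2}

/-- `P.IsGroundRule I α β`: the rule with head `α` and body `β` is in the grounded program, i.e. it
arises from a rule of `P` by instantiating its variables, in the order in which they occur along the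
chain, with constants `z 0, …, z (k + 1)` of the active domain. -/
def Program.IsGroundRule {EDB : Type v} {IDB : Type} {V : Type} (P : Program EDB IDB)
    (I : Finset (Fact EDB V)) (α : Fact IDB V) (β : List (Fact (Symbol EDB IDB) V)) : Prop :=
  ∃ r ∈ P.rules, ∃ z : ℕ → V, (∀ i ≤ r.body.length, z i ∈ activeDomain I) ∧
    α = (r.head, z 0, z r.body.length) ∧
    β = r.body.mapIdx fun i Q => (Q, z i, z (i + 1))

/-- Finite rooted labelled trees: the leaves are labelled with facts of the input database, the
internal nodes with IDB facts. -/
inductive DerivTree {EDB : Type v} (IDB : Type) {V : Type} (I : Finset (Fact EDB V)) where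
  | leaf (f : I) : DerivTree IDB I
  | node (α : Fact IDB V) (children : List (DerivTree IDB I)) : DerivTree IDB I

namespace DerivTree

variable {EDB : Type v} {IDB : Type} {V : Type} {I : Finset (Fact EDB V)}

/-- The label of the root. -/
def label : DerivTree IDB I → Fact (Symbol EDB IDB) V
  | leaf f => (Symbol.terminal f.1.1, f.1.2)
  | node α _ => (Symbol.nonterminal α.1, α.2)

/-- The labels of the leaves, from left to right, with repetitions. -/
def leaves : DerivTree IDB I → List I
  | leaf f => [f]
  | node _ children => (children.map leaves).flatten

/-- `β` is the label of some internal node. -/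
inductive IsInternalLabel (β : Fact IDB V) : DerivTree IDB I → Prop
  | root (children : List (DerivTree IDB I)) : IsInternalLabel β (node β children)
  | child (α : Fact IDB V) (children : List (DerivTree IDB I)) (c : DerivTree IDB I)
      (hc : c ∈ children) (h : IsInternalLabel β c) : IsInternalLabel β (node α children)

/-- Tight trees: no two internal nodes on a common path from a leaf to the root have the same
label. -/
inductive IsTight : DerivTree IDB I → Prop
  | leaf (f : I) : IsTight (leaf f)
  | node (α : Fact IDB V) (children : List (DerivTree IDB I))
      (h : ∀ c ∈ children, ¬ IsInternalLabel α c) (hc : ∀ c ∈ children, IsTight c) :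
      IsTight (node α children)

/-- Every internal node together with its children is an instance of a rule of the program. -/
inductive IsDerivation (P : Program EDB IDB) : DerivTree IDB I → Prop
  | leaf (f : I) : IsDerivation P (leaf f)
  | node (α : Fact IDB V) (children : List (DerivTree IDB I))
      (h : P.IsGroundRule I α (children.map label)) (hc : ∀ c ∈ children, IsDerivation P c) :
      IsDerivation P (node α children)

end DerivTree

/-- The tight proof trees of an IDB fact `α`. -/
def Program.tightProofTrees {EDB : Type v} {IDB : Type} {V : Type} (P : Program EDB IDB)
    (I : Finset (Fact EDB V)) (α : Fact IDB V) : Set (DerivTree IDB I) :=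
  {τ | τ.IsDerivation P ∧ τ.IsTight ∧ τ.label = (Symbol.nonterminal α.1, α.2)}

theorem activeDomain_finite {EDB : Type v} {V : Type} (I : Finset (Fact EDB V)) :
    (activeDomain I).Finite := by
  refine ((I.finite_toSet.image fun f => f.2.1).union
    (I.finite_toSet.image fun f => f.2.2)).subset ?_
  rintro a ⟨f, hf, rfl | rfl⟩
  · exact Or.inl ⟨f, hf, rfl⟩
  · exact Or.inr ⟨f, hf, rfl⟩

theorem finite_lists_of_length_le {T : Type*} {s : Set T} (hs : s.Finite) (n : ℕ) :
    {l : List T | l.length ≤ n ∧ ∀ x ∈ l, x ∈ s}.Finite := by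
  induction n with
  | zero =>
    refine (Set.finite_singleton ([] : List T)).subset ?_
    rintro l ⟨hl, -⟩
    simpa using hl
  | succ n ih =>
    refine ((Set.finite_singleton ([] : List T)).union
      ((hs.prod ih).image fun p => p.1 :: p.2)).subset ?_
    rintro (_ | ⟨a, l⟩) ⟨hl, hm⟩
    · exact Or.inl rfl
    · refine Or.inr ⟨(a, l), ⟨hm a (by simp), ?_, fun x hx => hm x (by simp [hx])⟩, rfl⟩
      simpa using hl

/-- There are only finitely many tight proof trees. -/
theorem Program.tightProofTrees_finite {EDB : Type v} {IDB : Type} {V : Type}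
    (P : Program EDB IDB) (I : Finset (Fact EDB V)) (α : Fact IDB V) :
    (P.tightProofTrees I α).Finite := by
  classical
  obtain ⟨N, hN⟩ : ∃ N, ∀ r ∈ P.rules, r.body.length ≤ N :=
    ⟨P.rules.sup fun r => r.body.length,
      fun r hr => Finset.le_sup (f := fun r : ChainRule EDB IDB => r.body.length) hr⟩
  have key : ∀ (n : ℕ) (A : Finset (Fact IDB V)), A.card = n →
      {τ : DerivTree IDB I | τ.IsDerivation P ∧ τ.IsTight ∧
        ∀ β, τ.IsInternalLabel β → β ∈ A}.Finite := by
    intro n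
    induction n with
    | zero =>
      intro A hA
      refine (Set.finite_range fun f : I => (DerivTree.leaf f : DerivTree IDB I)).subset ?_
      rintro (f | ⟨β, cs⟩) ⟨-, -, h⟩
      · exact ⟨f, rfl⟩
      · have := h β (.root cs)
        simp [Finset.card_eq_zero.mp hA] at this
    | succ n ih =>
      intro A hA
      have hfin : ((A : Set (Fact IDB V)).Finite) := A.finite_toSet
      refine ((Set.finite_range fun f : I => (DerivTree.leaf f : DerivTree IDB I)).union
        (hfin.biUnion (t := fun β => (fun cs => DerivTree.node β cs) ''
          {l : List (DerivTree IDB I) | l.length ≤ N ∧ ∀ x ∈ l, x ∈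
            {τ : DerivTree IDB I | τ.IsDerivation P ∧ τ.IsTight ∧
              ∀ γ, τ.IsInternalLabel γ → γ ∈ A.erase β}}) ?_)).subset ?_
      · intro β hβ
        refine (finite_lists_of_length_le (ih _ ?_) N).image _
        rw [Finset.card_erase_of_mem hβ, hA]
        rfl
      · rintro (f | ⟨β, cs⟩) ⟨hd, ht, h⟩
        · exact Or.inl ⟨f, rfl⟩
        · refine Or.inr (Set.mem_biUnion (h β (.root cs)) ⟨cs, ⟨?_, ?_⟩, rfl⟩)
          · cases hd with
            | node _ _ hg _ =>
              obtain ⟨r, hr, z, -, -, hb⟩ := hg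
              have := congrArg List.length hb
              simp only [List.length_map, List.length_mapIdx] at this
              rw [this]
              exact hN r hr
          · intro c hc
            cases hd with
            | node _ _ hg hcd =>
              cases ht with
              | node _ _ hn hct =>
                refine ⟨hcd c hc, hct c hc, fun γ hγ => Finset.mem_erase.mpr ⟨?_, ?_⟩⟩
                · rintro rfl
                  exact hn c hc hγ
                · exact h γ (.child β cs c hc hγ)
  have hdom := activeDomain_finite I
  have hA : ((P.rules.image fun r => r.head : Finset IDB) : Set IDB) ×ˢ
      (activeDomain I ×ˢ activeDomain I) |>.Finite :=
    (Finset.finite_toSet _).prod (hdom.prod hdom)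
  refine (key _ hA.toFinset rfl).subset ?_
  rintro τ ⟨hd, ht, -⟩
  refine ⟨hd, ht, fun β hβ => ?_⟩
  rw [Set.Finite.mem_toFinset]
  clear ht
  induction hβ with
  | root cs =>
    cases hd with
    | node _ _ hg _ =>
      obtain ⟨r, hr, z, hz, hα, -⟩ := hg
      rw [hα]
      exact ⟨by simpa using ⟨r, hr, rfl⟩, hz 0 (Nat.zero_le _), hz _ le_rfl⟩
  | child _ cs c hc _ ih =>
    cases hd with
    | node _ _ _ hcd => exact ih (hcd c hc)

/-- The provenance polynomial of the fact `T(s, t)`, `T` being the target predicate: the sum, over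
all tight proof trees of the fact, of the product of the variables of the leaves. The variables are
the facts of the input database. -/
noncomputable def Program.provenance {EDB : Type v} {IDB : Type} {V : Type}
    (P : Program EDB IDB) (I : Finset (Fact EDB V)) (s t : V) : MvPolynomial I ℕ :=
  ∑ τ ∈ (P.tightProofTrees_finite I (P.target, s, t)).toFinset,
    (τ.leaves.map MvPolynomial.X).prod

/-! ### Semirings and circuits -/

/-- A semiring is absorptive if `1 ⊕ x = 1` for all `x`. -/
def IsAbsorptive (S : Type u) [CommSemiring S] : Prop :=
  ∀ x : S, 1 + x = 1

/-- Two polynomials are equivalent over `S` if they define the same function over `S`. -/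
def EquivOver (S : Type u) [CommSemiring S] {X : Type v} (p q : MvPolynomial X ℕ) : Prop :=
  ∀ φ : X → S, MvPolynomial.aeval φ p = MvPolynomial.aeval φ q

/-- The `k`-th gate of a circuit: an input gate carrying a variable or a constant, or an inner gate
of fan-in two whose arguments are among the gates `0, …, k - 1`. -/
inductive Gate (X : Type v) (k : ℕ) where
  | var (x : X) : Gate X k
  | zero : Gate X k
  | one : Gate X k
  | add (i j : Fin k) : Gate X k
  | mul (i j : Fin k) : Gate X k

/-- A circuit: a directed acyclic graph of gates, listed in a topological order, with a designated
output gate. Its size is the number of all gates, including the input gates. -/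
structure Circuit (X : Type v) where
  size : ℕ
  gate : (k : Fin size) → Gate X k
  output : Fin size

namespace Circuit

variable {X : Type v}

/-- The polynomial produced at the `k`-th gate. -/
noncomputable def polyAt (F : Circuit X) (k : Fin F.size) : MvPolynomial X ℕ :=
  match F.gate k with
  | .var x => MvPolynomial.X x
  | .zero => 0
  | .one => 1
  | .add i j => F.polyAt ⟨i, i.2.trans k.2⟩ + F.polyAt ⟨j, j.2.trans k.2⟩
  | .mul i j => F.polyAt ⟨i, i.2.trans k.2⟩ * F.polyAt ⟨j, j.2.trans k.2⟩
termination_by k.val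

/-- The length of a longest path from an input gate to the `k`-th gate. -/
def depthAt (F : Circuit X) (k : Fin F.size) : ℕ :=
  match F.gate k with
  | .var _ => 0
  | .zero => 0
  | .one => 0
  | .add i j => max (F.depthAt ⟨i, i.2.trans k.2⟩) (F.depthAt ⟨j, j.2.trans k.2⟩) + 1
  | .mul i j => max (F.depthAt ⟨i, i.2.trans k.2⟩) (F.depthAt ⟨j, j.2.trans k.2⟩) + 1
termination_by k.val

/-- The depth of a circuit: the length of a longest path from an input gate to the output gate. -/
def depth (F : Circuit X) : ℕ := F.depthAt F.output

/-- The circuit computes `p` over `S`: the polynomial it produces is equivalent to `p` over `S`. -/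
def Computes (F : Circuit X) (S : Type u) [CommSemiring S] (p : MvPolynomial X ℕ) : Prop :=
  EquivOver S (F.polyAt F.output) p

end Circuit

/-! ### Circuit complexity of programs -/

/-- The circuit size complexity over `S`: the largest, over all inputs with at most `m` facts and at
most `n` constants and all facts of the target predicate, of the least size of a circuit that
computes the provenance polynomial over `S`. -/
noncomputable def Program.sizeComplexity {EDB : Type v} {IDB : Type} (P : Program EDB IDB)
    (S : Type u) [CommSemiring S] (m n : ℕ) : ℕ∞ :=
  ⨆ (V : Type) (I : Finset (Fact EDB V)) (_ : I.card ≤ m) (_ : (activeDomain I).ncard ≤ n)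
    (s : V) (t : V), ⨅ (F : Circuit I) (_ : F.Computes S (P.provenance I s t)), (F.size : ℕ∞)

/-- The circuit depth complexity over `S`, defined likewise. -/
noncomputable def Program.depthComplexity {EDB : Type v} {IDB : Type} (P : Program EDB IDB)
    (S : Type u) [CommSemiring S] (m n : ℕ) : ℕ∞ :=
  ⨆ (V : Type) (I : Finset (Fact EDB V)) (_ : I.card ≤ m) (_ : (activeDomain I).ncard ≤ n)
    (s : V) (t : V), ⨅ (F : Circuit I) (_ : F.Computes S (P.provenance I s t)), (F.depth : ℕ∞)

/-- A size- and depth-preserving circuit reduction from `P` to `Q`, with constant `c`: every input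
and fact for `P` has a counterpart for `Q` on an input that is larger by at most a constant factor,
such that every circuit for the counterpart can be turned into a circuit, no larger and no deeper,
that computes the provenance polynomial of the original fact over every absorptive semiring over
which the given circuit computes the provenance polynomial of the counterpart. -/
def Program.CircuitReducesTo {EDB : Type v} {IDB : Type} {EDB' : Type w} {IDB' : Type}
    (P : Program EDB IDB) (Q : Program EDB' IDB') (c : ℕ) : Prop :=
  ∀ (V : Type) (I : Finset (Fact EDB V)) (s t : V),
    ∃ (V' : Type) (I' : Finset (Fact EDB' V')) (s' t' : V'),
      I'.card ≤ c * (I.card + 1) ∧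
      (activeDomain I').ncard ≤ c * ((activeDomain I).ncard + 1) ∧
      ∀ F' : Circuit I', ∃ F : Circuit I, F.size ≤ F'.size ∧ F.depth ≤ F'.depth ∧
        ∀ (S : Type u) [CommSemiring S], IsAbsorptive S →
          F'.Computes S (Q.provenance I' s' t') → F.Computes S (P.provenance I s t)

end ChainDatalog

/-! Over an absorptive semiring a sum absorbs every multiple of one of its terms, so two sums agree
as soon as each term of either is a multiple of a term of the other (`IsAbsorptive.sum_eq_sum`). The
leaves of a tight proof tree of `T(s, t)` form a walk from `s` to `t` with word in the language `L`.
Conversely, every such walk carries a proof tree, and cutting out repeated labels leaves a tight one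
whose leaves are a sublist of the walk (`exists_mem_tightProofTrees`). Hence provenance depends only
on the walks with word in `L`, and a reduction need only match walks, not trees
(`Circuit.Computes.subst`).

Walks are matched through the product of the input with a fixed finite transducer: each product fact
either reads one fact of the input, whose variable replaces its own, or reads nothing and is
replaced by the constant one. Such a substitution changes neither size nor depth
(`Program.CircuitReducesTo.of_transducer`).

The language of `transitiveClosure` consists of all non-empty unary words. From `P` to it, the
transducer is a finite automaton for `L`. In the other direction the pumping lemma provides words `x
(R y)ⁿ z` in `L`, and the transducer reads one edge for each copy of `R y`. -/

namespace ChainDatalog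

/-! ### Walks -/

section Walk

variable {EDB : Type v} {V : Type} {I : Finset (Fact EDB V)}

/-- The facts in the list form a walk from the first to the second given constant. -/
def IsWalk : V → List I → V → Prop
  | a, [], b => a = b
  | a, f :: p, b => f.1.2.1 = a ∧ IsWalk f.1.2.2 p b

@[simp] theorem isWalk_nil {a b : V} : IsWalk a ([] : List I) b ↔ a = b := Iff.rfl

@[simp] theorem isWalk_cons {a b : V} {f : I} {p : List I} :
    IsWalk a (f :: p) b ↔ f.1.2.1 = a ∧ IsWalk f.1.2.2 p b := Iff.rfl

theorem IsWalk.append {p q : List I} {a b c : V} (hp : IsWalk a p b) (hq : IsWalk b q c) :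
    IsWalk a (p ++ q) c := by
  induction p generalizing a with
  | nil => rw [isWalk_nil] at hp; subst hp; exact hq
  | cons f p ih => exact ⟨hp.1, ih hp.2⟩

/-- The word of the predicates along a list of facts. -/
def word (p : List I) : List EDB := p.map fun f => f.1.1

@[simp] theorem word_nil : word ([] : List I) = [] := rfl

@[simp] theorem word_cons (f : I) (p : List I) : word (f :: p) = f.1.1 :: word p := rfl

@[simp] theorem word_append (p q : List I) : word (p ++ q) = word p ++ word q :=
  List.map_append

theorem left_mem_activeDomain (f : I) : f.1.2.1 ∈ activeDomain I := ⟨f.1, f.2, Or.inl rfl⟩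

theorem right_mem_activeDomain (f : I) : f.1.2.2 ∈ activeDomain I := ⟨f.1, f.2, Or.inr rfl⟩

end Walk

/-! ### Derivation trees and walks -/

section Trees

variable {EDB : Type v} {IDB : Type} {V : Type} {I : Finset (Fact EDB V)} {P : Program EDB IDB}

theorem DerivTree.leaves_node (α : Fact IDB V) (cs : List (DerivTree IDB I)) :
    (DerivTree.node α cs).leaves = (cs.map DerivTree.leaves).flatten := by
  rw [DerivTree.leaves]

theorem DerivTree.leaves_leaf (f : I) :
    (DerivTree.leaf f : DerivTree IDB I).leaves = [f] := by
  rw [DerivTree.leaves]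

theorem isWalk_and_derives_of_children (cs : List (DerivTree IDB I))
    (body : List (Symbol EDB IDB)) (z : ℕ → V)
    (hl : cs.map DerivTree.label = body.mapIdx fun i Q => (Q, z i, z (i + 1)))
    (hc : ∀ c ∈ cs, IsWalk c.label.2.1 c.leaves c.label.2.2 ∧
      P.grammar.Derives [c.label.1] ((word c.leaves).map Symbol.terminal)) :
    IsWalk (z 0) (cs.map DerivTree.leaves).flatten (z body.length) ∧
      P.grammar.Derives body
        ((word (cs.map DerivTree.leaves).flatten).map Symbol.terminal) := by
  induction cs generalizing body z with
  | nil =>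
    have : body = [] := by simpa using hl.symm
    subst this
    exact ⟨rfl, ContextFreeGrammar.Derives.refl _⟩
  | cons c cs ih =>
    rcases body with _ | ⟨Q, body⟩
    · simp at hl
    · simp only [List.map_cons, List.mapIdx_cons, List.cons.injEq] at hl
      obtain ⟨h1, h2⟩ := ih body (fun i => z (i + 1)) hl.2 fun c hc' => hc c (by simp [hc'])
      obtain ⟨h3, h4⟩ := hc c (by simp)
      rw [hl.1] at h3 h4
      refine ⟨?_, ?_⟩
      · simpa using h3.append h1
      · have h5 := (h4.append_right body).trans
          (h2.append_left ((word c.leaves).map Symbol.terminal))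
        rw [List.map_cons, List.flatten_cons, word_append, List.map_append]
        exact h5

theorem DerivTree.IsDerivation.isWalk_and_derives {τ : DerivTree IDB I}
    (h : τ.IsDerivation P) :
    IsWalk τ.label.2.1 τ.leaves τ.label.2.2 ∧
      P.grammar.Derives [τ.label.1] ((word τ.leaves).map Symbol.terminal) := by
  induction h with
  | leaf f =>
    rw [DerivTree.leaves_leaf]
    exact ⟨⟨rfl, rfl⟩, ContextFreeGrammar.Derives.refl _⟩
  | node α cs h _ ih =>
    obtain ⟨r, hr, z, -, rfl, hl⟩ := h
    rw [DerivTree.leaves_node]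
    obtain ⟨h1, h2⟩ := isWalk_and_derives_of_children (P := P) cs r.body z hl ih
    refine ⟨h1, ContextFreeGrammar.Produces.trans_derives ?_ h2⟩
    exact ⟨r.toProduction, Finset.mem_map_of_mem _ hr, ContextFreeRule.Rewrites.input_output⟩

theorem DerivTree.IsDerivation.label_mem_activeDomain {τ : DerivTree IDB I}
    (h : τ.IsDerivation P) : τ.label.2.1 ∈ activeDomain I ∧ τ.label.2.2 ∈ activeDomain I := by
  cases h with
  | leaf f => exact ⟨left_mem_activeDomain f, right_mem_activeDomain f⟩
  | node α cs h _ =>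
    obtain ⟨r, hr, z, hz, rfl, hl⟩ := h
    exact ⟨hz _ (Nat.zero_le _), hz _ le_rfl⟩

/-- `IsForest P u a p b`: there is a chain of derivation trees from `a` to `b` whose root predicates
are listed in `u` and whose leaves are listed in `p`. -/
def IsForest (P : Program EDB IDB) : List (Symbol EDB IDB) → V → List I → V → Prop
  | [], a, p, b => a = b ∧ p = []
  | Q :: u, a, p, b => ∃ (τ : DerivTree IDB I) (c : V) (q : List I), τ.IsDerivation P ∧
      τ.label = (Q, a, c) ∧ p = τ.leaves ++ q ∧ IsForest P u c q b

theorem isForest_append {u v : List (Symbol EDB IDB)} {a b : V} {p : List I} :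
    IsForest P (u ++ v) a p b ↔
      ∃ c q r, p = q ++ r ∧ IsForest P u a q c ∧ IsForest P v c r b := by
  induction u generalizing a p with
  | nil =>
    constructor
    · intro h
      exact ⟨a, [], p, rfl, ⟨rfl, rfl⟩, h⟩
    · rintro ⟨c, q, r, rfl, ⟨rfl, rfl⟩, h⟩
      exact h
  | cons Q u ih =>
    constructor
    · rintro ⟨τ, c, q, hτ, hl, rfl, h⟩
      obtain ⟨d, q₁, q₂, rfl, h1, h2⟩ := ih.1 h
      exact ⟨d, τ.leaves ++ q₁, q₂, by simp, ⟨τ, c, q₁, hτ, hl, rfl, h1⟩, h2⟩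
    · rintro ⟨d, q, r, rfl, ⟨τ, c, q₁, hτ, hl, rfl, h1⟩, h2⟩
      exact ⟨τ, c, q₁ ++ r, hτ, hl, by simp, ih.2 ⟨d, q₁, r, rfl, h1, h2⟩⟩

theorem IsForest.exists_children {u : List (Symbol EDB IDB)} {a b : V} {p : List I}
    (h : IsForest P u a p b) (ha : a ∈ activeDomain I) :
    ∃ (cs : List (DerivTree IDB I)) (z : ℕ → V), (∀ c ∈ cs, c.IsDerivation P) ∧
      (∀ i ≤ u.length, z i ∈ activeDomain I) ∧ z 0 = a ∧ z u.length = b ∧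
      cs.map DerivTree.label = u.mapIdx (fun i Q => (Q, z i, z (i + 1))) ∧
      (cs.map DerivTree.leaves).flatten = p := by
  induction u generalizing a p with
  | nil =>
    obtain ⟨rfl, rfl⟩ := h
    exact ⟨[], fun _ => a, by simp, by simpa using ha, rfl, rfl, rfl, rfl⟩
  | cons Q u ih =>
    obtain ⟨τ, c, q, hτ, hl, rfl, h⟩ := h
    have hc := hτ.label_mem_activeDomain.2
    rw [hl] at hc
    obtain ⟨cs, z, h1, h2, rfl, h4, h5, rfl⟩ := ih h hc
    refine ⟨τ :: cs, fun i => Nat.casesOn i a z, ?_, ?_, rfl, h4, ?_, by simp⟩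
    · rintro c (_ | ⟨_, hc⟩)
      exacts [hτ, h1 _ ‹_›]
    · rintro (_ | i) hi
      exacts [ha, h2 i (by simpa using hi)]
    · simp [hl, h5]

theorem isForest_singleton {Q : Symbol EDB IDB} {a b : V} {p : List I} :
    IsForest P [Q] a p b ↔
      ∃ τ : DerivTree IDB I, τ.IsDerivation P ∧ τ.label = (Q, a, b) ∧ τ.leaves = p := by
  constructor
  · rintro ⟨τ, c, q, hτ, hl, rfl, rfl, rfl⟩
    exact ⟨τ, hτ, hl, by simp⟩
  · rintro ⟨τ, hτ, hl, rfl⟩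
    exact ⟨τ, b, [], hτ, hl, by simp, rfl, rfl⟩

theorem IsForest.fold {r : ChainRule EDB IDB} (hr : r ∈ P.rules) {a b : V} {p : List I}
    (h : IsForest P r.body a p b) : IsForest P [Symbol.nonterminal r.head] a p b := by
  -- Ground rules use constants of the active domain only. As the body is non-empty, `a` is an
  -- endpoint of the first tree.
  have ha : a ∈ activeDomain I := by
    rcases hb : r.body with _ | ⟨Q, u⟩
    · exact absurd hb r.body_ne_nil
    · rw [hb] at h
      obtain ⟨τ, c, q, hτ, hl, -, -⟩ := h
      have := hτ.label_mem_activeDomain.1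
      rwa [hl] at this
  obtain ⟨cs, z, h1, h2, rfl, rfl, h5, rfl⟩ := h.exists_children ha
  rw [isForest_singleton]
  exact ⟨.node (r.head, z 0, z r.body.length) cs, .node _ _ ⟨r, hr, z, h2, rfl, h5⟩ h1, rfl,
    DerivTree.leaves_node _ _⟩

theorem IsWalk.isForest {a b : V} {p : List I} (h : IsWalk a p b) :
    IsForest P ((word p).map Symbol.terminal) a p b := by
  induction p generalizing a with
  | nil => exact ⟨h, rfl⟩
  | cons f p ih =>
    obtain ⟨rfl, h⟩ := h
    exact ⟨.leaf f, f.1.2.2, p, .leaf f, rfl, by rw [DerivTree.leaves_leaf]; rfl, ih h⟩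

/-- The derivation is followed backwards: undoing one rewriting step folds the trees over a rule
body into a single tree, without changing the leaves. -/
theorem IsForest.of_derives {u v : List (Symbol EDB IDB)} (huv : P.grammar.Derives u v)
    {a b : V} {p : List I} (h : IsForest P v a p b) : IsForest P u a p b := by
  induction huv using Relation.ReflTransGen.head_induction_on with
  | refl => exact h
  | head huw _ ih =>
    obtain ⟨r', hr', hw⟩ := huw
    obtain ⟨r, hr, rfl⟩ := Finset.mem_map.1 hr'
    obtain ⟨x, y, rfl, rfl⟩ := hw.exists_parts
    obtain ⟨c, q₁, q₂, rfl, h1, h2⟩ := isForest_append.1 ih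
    obtain ⟨d, q₃, q₄, rfl, h3, h4⟩ := isForest_append.1 h1
    exact isForest_append.2 ⟨c, _, q₂, rfl, isForest_append.2 ⟨d, q₃, q₄, rfl, h3, h4.fold hr⟩, h2⟩

/-! ### Pruning -/

theorem DerivTree.IsInternalLabel.exists_subtree {β : Fact IDB V} {τ : DerivTree IDB I}
    (h : τ.IsInternalLabel β) (hd : τ.IsDerivation P) (ht : τ.IsTight) :
    ∃ cs : List (DerivTree IDB I), (DerivTree.node β cs).IsDerivation P ∧
      (DerivTree.node β cs).IsTight ∧ (DerivTree.node β cs).leaves.Sublist τ.leaves := by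
  induction h with
  | root cs => exact ⟨cs, hd, ht, List.Sublist.refl _⟩
  | child α cs c hc _ ih =>
    cases hd with
    | node _ _ _ hd =>
      cases ht with
      | node _ _ _ ht =>
        obtain ⟨ds, h1, h2, h3⟩ := ih (hd c hc) (ht c hc)
        refine ⟨ds, h1, h2, h3.trans ?_⟩
        rw [DerivTree.leaves_node]
        exact List.sublist_flatten_of_mem (List.mem_map_of_mem hc)

theorem exists_tight_children (cs : List (DerivTree IDB I))
    (h : ∀ c ∈ cs, ∃ d : DerivTree IDB I, d.IsDerivation P ∧ d.IsTight ∧ d.label = c.label ∧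
      d.leaves.Sublist c.leaves) :
    ∃ ds : List (DerivTree IDB I), (∀ d ∈ ds, d.IsDerivation P ∧ d.IsTight) ∧
      ds.map DerivTree.label = cs.map DerivTree.label ∧
      (ds.map DerivTree.leaves).flatten.Sublist (cs.map DerivTree.leaves).flatten := by
  induction cs with
  | nil => exact ⟨[], by simp, rfl, List.Sublist.refl _⟩
  | cons c cs ih =>
    obtain ⟨ds, h1, h2, h3⟩ := ih fun c hc => h c (by simp [hc])
    obtain ⟨d, h4, h5, h6, h7⟩ := h c (by simp)
    refine ⟨d :: ds, ?_, by simp [h2, h6], by simpa using h7.append h3⟩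
    rintro e (_ | ⟨_, he⟩)
    exacts [⟨h4, h5⟩, h1 _ ‹_›]

/-- Pruning goes from the leaves up. Once the children are tight, tightness can fail only because
the root label recurs below; the subtree at that recurrence is already tight and replaces the whole
tree. -/
theorem DerivTree.IsDerivation.exists_tight {τ : DerivTree IDB I} (h : τ.IsDerivation P) :
    ∃ τ' : DerivTree IDB I, τ'.IsDerivation P ∧ τ'.IsTight ∧ τ'.label = τ.label ∧
      τ'.leaves.Sublist τ.leaves := by
  induction h with
  | leaf f => exact ⟨_, .leaf f, .leaf f, rfl, List.Sublist.refl _⟩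
  | node α cs h _ ih =>
    obtain ⟨ds, h1, h2, h3⟩ := exists_tight_children cs ih
    have hds : (DerivTree.node α ds).IsDerivation P :=
      .node α ds (by rwa [h2]) fun d hd => (h1 d hd).1
    by_cases hi : ∃ d ∈ ds, d.IsInternalLabel α
    · obtain ⟨d, hd, hi⟩ := hi
      obtain ⟨es, h4, h5, h6⟩ := hi.exists_subtree (h1 d hd).1 (h1 d hd).2
      refine ⟨_, h4, h5, rfl, h6.trans ?_⟩
      rw [DerivTree.leaves_node]
      exact (List.sublist_flatten_of_mem (List.mem_map_of_mem hd)).trans h3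
    · push Not at hi
      refine ⟨_, hds, .node α ds hi fun d hd => (h1 d hd).2, rfl, ?_⟩
      rwa [DerivTree.leaves_node, DerivTree.leaves_node]

theorem isWalk_of_mem_tightProofTrees {s t : V} {τ : DerivTree IDB I}
    (h : τ ∈ P.tightProofTrees I (P.target, s, t)) :
    IsWalk s τ.leaves t ∧ word τ.leaves ∈ P.grammar.language := by
  obtain ⟨hd, -, hl⟩ := h
  have := hd.isWalk_and_derives
  rw [hl] at this
  exact this

/-- Pruning may change the word, so only a sublist of the walk survives. Its monomial divides that
of the walk, which is all that absorption needs. -/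
theorem exists_mem_tightProofTrees {s t : V} {p : List I} (hp : IsWalk s p t)
    (hw : word p ∈ P.grammar.language) :
    ∃ τ ∈ P.tightProofTrees I (P.target, s, t), τ.leaves.Sublist p := by
  obtain ⟨τ, hd, hl, rfl⟩ := isForest_singleton.1 (hp.isForest.of_derives (P := P) hw)
  obtain ⟨τ', h1, h2, h3, h4⟩ := hd.exists_tight
  exact ⟨τ', ⟨h1, h2, h3.trans hl⟩, h4⟩

end Trees

/-! ### Absorption -/

section Absorptive

variable {S : Type u} [CommSemiring S]

theorem IsAbsorptive.add_eq_of_dvd (hS : IsAbsorptive S) {a b : S} (h : a ∣ b) : b + a = a := by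
  obtain ⟨c, rfl⟩ := h
  calc a * c + a = a * (1 + c) := by ring
    _ = a := by rw [hS, mul_one]

theorem IsAbsorptive.sum_add_sum (hS : IsAbsorptive S) {ι κ : Type*} (s : Finset ι)
    (t : Finset κ) (f : ι → S) (g : κ → S) (h : ∀ i ∈ s, ∃ j ∈ t, g j ∣ f i) :
    ∑ i ∈ s, f i + ∑ j ∈ t, g j = ∑ j ∈ t, g j := by
  classical
  induction s using Finset.induction_on with
  | empty => simp
  | insert i s hi ih =>
    obtain ⟨j, hj, hd⟩ := h i (by simp)
    -- The term `g j` is split off from the second sum so that it can absorb `f i`.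
    rw [Finset.sum_insert hi, add_assoc, ih fun i hi => h i (by simp [hi]),
      ← Finset.add_sum_erase t g hj, ← add_assoc, hS.add_eq_of_dvd hd]

/-- Each sum absorbs the other, so both equal their total. -/
theorem IsAbsorptive.sum_eq_sum (hS : IsAbsorptive S) {ι κ : Type*} (s : Finset ι)
    (t : Finset κ) (f : ι → S) (g : κ → S) (h : ∀ i ∈ s, ∃ j ∈ t, g j ∣ f i)
    (h' : ∀ j ∈ t, ∃ i ∈ s, f i ∣ g j) : ∑ i ∈ s, f i = ∑ j ∈ t, g j := by
  rw [← hS.sum_add_sum s t f g h, add_comm, hS.sum_add_sum t s g f h']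

end Absorptive

/-! ### Substitution in circuits -/

section Subst

variable {X : Type v} {Y : Type w}

/-- Replace each variable of a gate by a variable or by the constant one. -/
def Gate.subst (σ : X → Option Y) {k : ℕ} : Gate X k → Gate Y k
  | .var x => (σ x).elim .one .var
  | .zero => .zero
  | .one => .one
  | .add i j => .add i j
  | .mul i j => .mul i j

/-- Replace each variable of a circuit by a variable or by the constant one. -/
def Circuit.subst (σ : X → Option Y) (F : Circuit X) : Circuit Y where
  size := F.size
  gate k := (F.gate k).subst σ
  output := F.output

theorem Circuit.polyAt_subst (σ : X → Option Y) (F : Circuit X) (n : ℕ) (hn : n < F.size) :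
    (F.subst σ).polyAt ⟨n, hn⟩ =
      MvPolynomial.aeval (fun x => (σ x).elim 1 MvPolynomial.X) (F.polyAt ⟨n, hn⟩) := by
  induction n using Nat.strong_induction_on with
  | _ n ih =>
    have hg : (F.subst σ).gate ⟨n, hn⟩ = (F.gate ⟨n, hn⟩).subst σ := rfl
    rw [Circuit.polyAt, Circuit.polyAt, hg]
    rcases F.gate ⟨n, hn⟩ with x | _ | _ | ⟨i, j⟩ | ⟨i, j⟩
    · cases h : σ x <;> simp [Gate.subst, h]
    · simp [Gate.subst]
    · simp [Gate.subst]
    · simp only [Gate.subst, map_add]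
      exact congrArg₂ (· + ·) (ih i i.2 (i.2.trans hn)) (ih j j.2 (j.2.trans hn))
    · simp only [Gate.subst, map_mul]
      exact congrArg₂ (· * ·) (ih i i.2 (i.2.trans hn)) (ih j j.2 (j.2.trans hn))

theorem Circuit.depthAt_subst (σ : X → Option Y) (F : Circuit X) (n : ℕ) (hn : n < F.size) :
    (F.subst σ).depthAt ⟨n, hn⟩ = F.depthAt ⟨n, hn⟩ := by
  induction n using Nat.strong_induction_on with
  | _ n ih =>
    have hg : (F.subst σ).gate ⟨n, hn⟩ = (F.gate ⟨n, hn⟩).subst σ := rfl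
    rw [Circuit.depthAt, Circuit.depthAt, hg]
    rcases F.gate ⟨n, hn⟩ with x | _ | _ | ⟨i, j⟩ | ⟨i, j⟩
    · cases h : σ x <;> simp [Gate.subst, h]
    · simp [Gate.subst]
    · simp [Gate.subst]
    · simp only [Gate.subst]
      exact congrArg (· + 1)
        (congrArg₂ max (ih i i.2 (i.2.trans hn)) (ih j j.2 (j.2.trans hn)))
    · simp only [Gate.subst]
      exact congrArg (· + 1)
        (congrArg₂ max (ih i i.2 (i.2.trans hn)) (ih j j.2 (j.2.trans hn)))

end Subst

/-! ### Reductions from correspondences of walks -/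

section Reduction

variable {EA : Type v} {IA : Type} {EB : Type w} {IB : Type}
  {A : Program EA IA} {B : Program EB IB}

theorem aeval_provenance {S : Type u} [CommSemiring S] {V : Type} (I : Finset (Fact EA V))
    (s t : V) (φ : I → S) :
    MvPolynomial.aeval φ (A.provenance I s t) =
      ∑ τ ∈ (A.tightProofTrees_finite I (A.target, s, t)).toFinset, (τ.leaves.map φ).prod := by
  simp [Program.provenance, map_sum, map_list_prod, List.map_map, Function.comp_def]

theorem prod_map_elim {X : Type v} {Y : Type w} {S : Type u} [CommSemiring S]
    (σ : X → Option Y) (φ : Y → S) (p : List X) :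
    (p.map fun x => (σ x).elim 1 φ).prod = ((p.filterMap σ).map φ).prod := by
  induction p with
  | nil => rfl
  | cons x p ih => cases h : σ x <;> simp [h, ih]

/-- Evaluating the substituted circuit at `φ` evaluates `F'` at an assignment that turns the
monomial of a walk `p'` into that of `p'.filterMap σ`. Each tree on one side gives a walk there,
then a walk on the other side, then by pruning a tree whose monomial divides the given one. No
bijection between walks is required. -/
theorem Circuit.Computes.subst {S : Type u} [CommSemiring S] (hS : IsAbsorptive S)
    {V V' : Type} {I : Finset (Fact EA V)} {I' : Finset (Fact EB V')} {s t : V} {s' t' : V'}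
    (σ : I' → Option I)
    (hAB : ∀ p, IsWalk s p t → word p ∈ A.grammar.language →
      ∃ p', IsWalk s' p' t' ∧ word p' ∈ B.grammar.language ∧ p'.filterMap σ = p)
    (hBA : ∀ p', IsWalk s' p' t' → word p' ∈ B.grammar.language →
      IsWalk s (p'.filterMap σ) t ∧ word (p'.filterMap σ) ∈ A.grammar.language)
    {F' : Circuit I'} (hF : F'.Computes S (B.provenance I' s' t')) :
    (F'.subst σ).Computes S (A.provenance I s t) := by
  intro φ
  have h1 : MvPolynomial.aeval φ ((F'.subst σ).polyAt (F'.subst σ).output) =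
      MvPolynomial.aeval (fun x => (σ x).elim 1 φ) (F'.polyAt F'.output) := by
    have h0 := Circuit.polyAt_subst σ F' F'.output.1 F'.output.2
    have h2 : ∀ q : MvPolynomial I' ℕ, MvPolynomial.aeval φ
        (MvPolynomial.aeval (fun x => (σ x).elim (1 : MvPolynomial I ℕ) MvPolynomial.X) q) =
        MvPolynomial.aeval (fun x => (σ x).elim 1 φ) q := by
      intro q
      rw [← AlgHom.comp_apply, MvPolynomial.comp_aeval]
      congr 2
      funext x
      cases σ x <;> simp
    exact (congrArg (MvPolynomial.aeval φ) h0).trans (h2 _)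
  rw [h1, hF, aeval_provenance, aeval_provenance]
  refine hS.sum_eq_sum _ _ _ _ ?_ ?_
  · intro τ' hτ'
    obtain ⟨h2, h3⟩ := isWalk_of_mem_tightProofTrees ((Set.Finite.mem_toFinset _).1 hτ')
    obtain ⟨h4, h5⟩ := hBA _ h2 h3
    obtain ⟨τ, hτ, hs⟩ := exists_mem_tightProofTrees h4 h5
    refine ⟨τ, (Set.Finite.mem_toFinset _).2 hτ, ?_⟩
    rw [prod_map_elim]
    exact (hs.map φ).prod_dvd_prod
  · intro τ hτ
    obtain ⟨h2, h3⟩ := isWalk_of_mem_tightProofTrees ((Set.Finite.mem_toFinset _).1 hτ)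
    obtain ⟨p', h4, h5, h6⟩ := hAB _ h2 h3
    obtain ⟨τ', hτ', hs⟩ := exists_mem_tightProofTrees h4 h5
    refine ⟨τ', (Set.Finite.mem_toFinset _).2 hτ', ?_⟩
    rw [prod_map_elim, ← h6]
    exact ((hs.filterMap σ).map φ).prod_dvd_prod

theorem Program.CircuitReducesTo.mono {c d : ℕ}
    (h : Program.CircuitReducesTo.{u} A B c) (hcd : c ≤ d) :
    Program.CircuitReducesTo.{u} A B d := by
  intro V I s t
  obtain ⟨V', I', s', t', h1, h2, h3⟩ := h V I s t
  exact ⟨V', I', s', t', h1.trans (Nat.mul_le_mul_right _ hcd),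
    h2.trans (Nat.mul_le_mul_right _ hcd), h3⟩

theorem Program.CircuitReducesTo.sizeComplexity_le {c : ℕ}
    (h : Program.CircuitReducesTo.{u} A B c) (S : Type u) [CommSemiring S]
    (hS : IsAbsorptive S) (m n : ℕ) :
    A.sizeComplexity S m n ≤ B.sizeComplexity S (c * (m + 1)) (c * (n + 1)) := by
  refine iSup_le fun V => iSup_le fun I => iSup_le fun hm => iSup_le fun hn => iSup_le fun s =>
    iSup_le fun t => ?_
  obtain ⟨V', I', s', t', h1, h2, h3⟩ := h V I s t
  refine le_iSup_of_le V' (le_iSup_of_le I' (le_iSup_of_le (h1.trans (by gcongr))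
    (le_iSup_of_le (h2.trans (by gcongr)) (le_iSup_of_le s' (le_iSup_of_le t' ?_)))))
  refine le_iInf fun F' => le_iInf fun hF' => ?_
  obtain ⟨F, h4, -, h5⟩ := h3 F'
  exact (iInf₂_le F (h5 S hS hF')).trans (by exact_mod_cast h4)

theorem Program.CircuitReducesTo.depthComplexity_le {c : ℕ}
    (h : Program.CircuitReducesTo.{u} A B c) (S : Type u) [CommSemiring S]
    (hS : IsAbsorptive S) (m n : ℕ) :
    A.depthComplexity S m n ≤ B.depthComplexity S (c * (m + 1)) (c * (n + 1)) := by
  refine iSup_le fun V => iSup_le fun I => iSup_le fun hm => iSup_le fun hn => iSup_le fun s =>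
    iSup_le fun t => ?_
  obtain ⟨V', I', s', t', h1, h2, h3⟩ := h V I s t
  refine le_iSup_of_le V' (le_iSup_of_le I' (le_iSup_of_le (h1.trans (by gcongr))
    (le_iSup_of_le (h2.trans (by gcongr)) (le_iSup_of_le s' (le_iSup_of_le t' ?_)))))
  refine le_iInf fun F' => le_iInf fun hF' => ?_
  obtain ⟨F, -, h4, h5⟩ := h3 F'
  exact (iInf₂_le F (h5 S hS hF')).trans (by exact_mod_cast h4)

end Reduction

/-! ### Reductions from transducers -/

section Transducer

variable {α : Type*} {β : Type*} {Q : Type*}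

/-- `Run Δ q x y q'`: the transducer with the transitions `Δ` can go from the state `q` to the state
`q'` while reading the word `x` and writing the word `y`. A transition `(q, o, B, q')` reads the
letter in `o`, if there is one, and writes `B`. -/
inductive Run (Δ : Finset (Q × Option α × β × Q)) : Q → List α → List β → Q → Prop
  | nil (q : Q) : Run Δ q [] [] q
  | move {q q' q'' : Q} {A : α} {B : β} {x : List α} {y : List β}
      (h : (q, some A, B, q') ∈ Δ) (hr : Run Δ q' x y q'') : Run Δ q (A :: x) (B :: y) q''
  | stay {q q' q'' : Q} {B : β} {x : List α} {y : List β}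
      (h : (q, none, B, q') ∈ Δ) (hr : Run Δ q' x y q'') : Run Δ q x (B :: y) q''

theorem Run.append {Δ : Finset (Q × Option α × β × Q)} {q q' q'' : Q} {x x' : List α}
    {y y' : List β} (h : Run Δ q x y q') (h' : Run Δ q' x' y' q'') :
    Run Δ q (x ++ x') (y ++ y') q'' := by
  induction h with
  | nil => exact h'
  | move h _ ih => exact .move h (ih h')
  | stay h _ ih => exact .stay h (ih h')

end Transducer

/-! ### The product of an input database with a transducer -/

section Product

variable {EA : Type v} {EB : Type w} {Q : Type*} {V : Type}

/-- The fact written by a transition that reads the fact `e`. -/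
def moveFact (ι : Q → ℕ) (d : Q × Option EA × EB × Q) (e : Fact EA V) : Fact EB (V × ℕ) :=
  (d.2.2.1, (e.2.1, ι d.1), (e.2.2, ι d.2.2.2))

/-- The fact written by a transition that reads nothing at the constant `a`. -/
def stayFact (ι : Q → ℕ) (d : Q × Option EA × EB × Q) (a : V) : Fact EB (V × ℕ) :=
  (d.2.2.1, (a, ι d.1), (a, ι d.2.2.2))

open Classical in
/-- The product of the input database `I` with a transducer. -/
noncomputable def productInput (ι : Q → ℕ) (Δ : Finset (Q × Option EA × EB × Q))
    (I : Finset (Fact EA V)) (D : Finset V) : Finset (Fact EB (V × ℕ)) :=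
  ((Δ ×ˢ I).filter fun p => p.1.2.1 = some p.2.1).image (fun p => moveFact ι p.1 p.2) ∪
    ((Δ ×ˢ D).filter fun p => p.1.2.1 = none).image (fun p => stayFact ι p.1 p.2)

variable {ι : Q → ℕ} {Δ : Finset (Q × Option EA × EB × Q)} {I : Finset (Fact EA V)} {D : Finset V}

theorem mem_productInput {f : Fact EB (V × ℕ)} :
    f ∈ productInput ι Δ I D ↔
      (∃ d ∈ Δ, ∃ e ∈ I, d.2.1 = some e.1 ∧ f = moveFact ι d e) ∨
        ∃ d ∈ Δ, ∃ a ∈ D, d.2.1 = none ∧ f = stayFact ι d a := by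
  classical
  simp only [productInput, Finset.mem_union, Finset.mem_image, Finset.mem_filter,
    Finset.mem_product]
  refine or_congr ?_ ?_
  · constructor
    · rintro ⟨⟨d, e⟩, ⟨⟨hd, he⟩, h⟩, rfl⟩
      exact ⟨d, hd, e, he, h, rfl⟩
    · rintro ⟨d, hd, e, he, h, rfl⟩
      exact ⟨(d, e), ⟨⟨hd, he⟩, h⟩, rfl⟩
  · constructor
    · rintro ⟨⟨d, a⟩, ⟨⟨hd, ha⟩, h⟩, rfl⟩
      exact ⟨d, hd, a, ha, h, rfl⟩
    · rintro ⟨d, hd, a, ha, h, rfl⟩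
      exact ⟨(d, a), ⟨⟨hd, ha⟩, h⟩, rfl⟩

theorem card_productInput_le : (productInput ι Δ I D).card ≤ Δ.card * (I.card + D.card) := by
  classical
  refine (Finset.card_union_le _ _).trans ?_
  rw [mul_add, ← Finset.card_product, ← Finset.card_product]
  exact Nat.add_le_add (Finset.card_image_le.trans (Finset.card_filter_le _ _))
    (Finset.card_image_le.trans (Finset.card_filter_le _ _))

theorem ncard_activeDomain_productInput_le (hD : activeDomain I ⊆ D) :
    (activeDomain (productInput ι Δ I D)).ncard ≤ 2 * Δ.card * D.card := by
  classical
  have hsub : activeDomain (productInput ι Δ I D) ⊆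
      ((D ×ˢ (Δ.image (fun d => ι d.1) ∪ Δ.image (fun d => ι d.2.2.2)) : Finset (V × ℕ)) :
        Set (V × ℕ)) := by
    rintro x ⟨f, hf, hx⟩
    simp only [Finset.coe_product, Set.mem_prod, Finset.mem_coe, Finset.mem_union,
      Finset.mem_image]
    rcases mem_productInput.1 hf with ⟨d, hd, e, he, -, rfl⟩ | ⟨d, hd, a, ha, -, rfl⟩
    · rcases hx with rfl | rfl
      · exact ⟨hD ⟨e, he, Or.inl rfl⟩, Or.inl ⟨d, hd, rfl⟩⟩
      · exact ⟨hD ⟨e, he, Or.inr rfl⟩, Or.inr ⟨d, hd, rfl⟩⟩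
    · rcases hx with rfl | rfl
      · exact ⟨ha, Or.inl ⟨d, hd, rfl⟩⟩
      · exact ⟨ha, Or.inr ⟨d, hd, rfl⟩⟩
  refine (Set.ncard_le_ncard hsub (Finset.finite_toSet _)).trans ?_
  rw [Set.ncard_coe_finset, Finset.card_product, mul_comm]
  refine Nat.mul_le_mul_right _ ((Finset.card_union_le _ _).trans ?_)
  rw [two_mul]
  exact Nat.add_le_add Finset.card_image_le Finset.card_image_le

open Classical in
/-- The fact of `I` that is read along a fact of the product, if there is one. -/
noncomputable def readFact (ι : Q → ℕ) (Δ : Finset (Q × Option EA × EB × Q))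
    (I : Finset (Fact EA V)) (D : Finset V) (f : productInput ι Δ I D) : Option I :=
  if h : ∃ e : I, ∃ d ∈ Δ, d.2.1 = some e.1.1 ∧ f.1 = moveFact ι d e.1 then some h.choose else none

/-- The source, the target and the written letter of a transition determine the letter read. -/
def IsDetermined (Δ : Finset (Q × Option EA × EB × Q)) : Prop :=
  ∀ q o o' B q', (q, o, B, q') ∈ Δ → (q, o', B, q') ∈ Δ → o = o'

/-- A product fact records the constants, the states and the letter written, but not the letter
read. Determinedness recovers the latter, so the choice in `readFact` is forced. -/
theorem readFact_move (hι : Function.Injective ι) (hΔ : IsDetermined Δ)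
    {d : Q × Option EA × EB × Q} (hd : d ∈ Δ) (e : I) (hde : d.2.1 = some e.1.1)
    (f : productInput ι Δ I D) (hf : f.1 = moveFact ι d e.1) : readFact ι Δ I D f = some e := by
  have h : ∃ e : I, ∃ d ∈ Δ, d.2.1 = some e.1.1 ∧ f.1 = moveFact ι d e.1 := ⟨e, d, hd, hde, hf⟩
  rw [readFact, dif_pos h]
  obtain ⟨d', hd', hde', hf'⟩ := h.choose_spec
  generalize h.choose = e' at *
  obtain ⟨q, o, B, q'⟩ := d
  obtain ⟨q₁, o', B', q₁'⟩ := d'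
  obtain ⟨⟨R, a, b⟩, he⟩ := e
  obtain ⟨⟨R', a', b'⟩, he'⟩ := e'
  rw [hf] at hf'
  simp only [moveFact, Prod.mk.injEq] at hf' hde hde'
  obtain ⟨rfl, ⟨rfl, h1⟩, rfl, h2⟩ := hf'
  obtain rfl := hι h1
  obtain rfl := hι h2
  obtain rfl := hΔ _ _ _ _ _ hd hd'
  rw [hde] at hde'
  obtain rfl := Option.some.inj hde'
  rfl

/-- Determinedness excludes that a silent fact at `a` coincides with the fact written on reading a
loop `R(a, a)`. -/
theorem readFact_stay (hι : Function.Injective ι) (hΔ : IsDetermined Δ)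
    {d : Q × Option EA × EB × Q} (hd : d ∈ Δ) {a : V} (hda : d.2.1 = none)
    (f : productInput ι Δ I D) (hf : f.1 = stayFact ι d a) : readFact ι Δ I D f = none := by
  rw [readFact, dif_neg]
  rintro ⟨e, d', hd', hde', hf'⟩
  obtain ⟨q, o, B, q'⟩ := d
  obtain ⟨q₁, o', B', q₁'⟩ := d'
  rw [hf] at hf'
  simp only [moveFact, stayFact, Prod.mk.injEq] at hf' hda hde'
  obtain ⟨rfl, ⟨-, h1⟩, -, h2⟩ := hf'
  obtain rfl := hι h1
  obtain rfl := hι h2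
  obtain rfl := hΔ _ _ _ _ _ hd hd'
  rw [hda] at hde'
  simp at hde'

theorem Run.exists_isWalk (hι : Function.Injective ι) (hΔ : IsDetermined Δ)
    (hD : activeDomain I ⊆ D) {q q' : Q} {x : List EA} {y : List EB} (h : Run Δ q x y q')
    {a b : V} (ha : a ∈ D) {p : List I} (hp : IsWalk a p b) (hx : word p = x) :
    ∃ p' : List (productInput ι Δ I D), IsWalk (a, ι q) p' (b, ι q') ∧ word p' = y ∧
      p'.filterMap (readFact ι Δ I D) = p := by
  induction h generalizing a p with
  | nil =>
    obtain rfl : p = [] := by simpa [word] using hx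
    obtain rfl := hp
    exact ⟨[], rfl, rfl, rfl⟩
  | @move q q' _ A B x y h _ ih =>
    rcases p with _ | ⟨e, p⟩
    · simp at hx
    · simp only [word_cons, List.cons.injEq] at hx
      obtain ⟨rfl, hp⟩ := hp
      obtain ⟨p', h1, h2, h3⟩ := ih (hD (right_mem_activeDomain e)) hp hx.2
      have hde : (q, some A, B, q').2.1 = some e.1.1 := congrArg some hx.1.symm
      refine ⟨⟨moveFact ι (q, some A, B, q') e.1,
        mem_productInput.2 (Or.inl ⟨_, h, e.1, e.2, hde, rfl⟩)⟩ :: p', ⟨rfl, h1⟩, ?_, ?_⟩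
      · rw [word_cons, h2]
        rfl
      · rw [List.filterMap_cons, readFact_move hι hΔ h e hde _ rfl, h3]
  | @stay q q' _ B x y h _ ih =>
    obtain ⟨p', h1, h2, h3⟩ := ih ha hp hx
    refine ⟨⟨stayFact ι (q, none, B, q') a,
      mem_productInput.2 (Or.inr ⟨_, h, a, ha, rfl, rfl⟩)⟩ :: p', ⟨rfl, h1⟩, ?_, ?_⟩
    · rw [word_cons, h2]
      rfl
    · rw [List.filterMap_cons, readFact_stay hι hΔ h rfl _ rfl, h3]

theorem IsWalk.exists_run (hι : Function.Injective ι) (hΔ : IsDetermined Δ)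
    {p' : List (productInput ι Δ I D)} {a b : V} {q q' : Q}
    (h : IsWalk (a, ι q) p' (b, ι q')) :
    IsWalk a (p'.filterMap (readFact ι Δ I D)) b ∧
      Run Δ q (word (p'.filterMap (readFact ι Δ I D))) (word p') q' := by
  induction p' generalizing a q with
  | nil =>
    rw [isWalk_nil, Prod.mk.injEq] at h
    obtain ⟨rfl, h⟩ := h
    obtain rfl := hι h
    exact ⟨rfl, .nil q⟩
  | cons f p' ih =>
    obtain ⟨h1, h2⟩ := h
    rcases mem_productInput.1 f.2 with ⟨⟨q₁, o, B, q₂⟩, hd, e, he, hde, hf⟩ |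
      ⟨⟨q₁, o, B, q₂⟩, hd, c, hc, hdc, hf⟩
    · have hr := readFact_move hι hΔ hd ⟨e, he⟩ hde f hf
      obtain ⟨⟨B', x, y⟩, hf'⟩ := f
      simp only at hf hde
      subst hde
      cases hf
      rw [Prod.mk.injEq] at h1
      obtain ⟨rfl, h1⟩ := h1
      obtain rfl := hι h1
      obtain ⟨h3, h4⟩ := ih h2
      rw [List.filterMap_cons, hr]
      exact ⟨⟨rfl, h3⟩, .move hd h4⟩
    · have hr := readFact_stay hι hΔ hd hdc f hf
      obtain ⟨⟨B', x, y⟩, hf'⟩ := f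
      simp only at hf hdc
      subst hdc
      cases hf
      rw [Prod.mk.injEq] at h1
      obtain ⟨rfl, h1⟩ := h1
      obtain rfl := hι h1
      obtain ⟨h3, h4⟩ := ih h2
      rw [List.filterMap_cons, hr]
      exact ⟨h3, .stay hd h4⟩

theorem ncard_activeDomain_le (I : Finset (Fact EA V)) :
    (activeDomain I).ncard ≤ 2 * I.card := by
  classical
  have hsub : activeDomain I ⊆
      ((I.image (fun f => f.2.1) ∪ I.image (fun f => f.2.2) : Finset V) : Set V) := by
    rintro a ⟨f, hf, rfl | rfl⟩
    · exact Finset.mem_coe.2 (Finset.mem_union_left _ (Finset.mem_image_of_mem _ hf))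
    · exact Finset.mem_coe.2
        (Finset.mem_union_right _ (Finset.mem_image_of_mem (fun f => f.2.2) hf))
  refine (Set.ncard_le_ncard hsub (Finset.finite_toSet _)).trans ?_
  rw [Set.ncard_coe_finset, two_mul]
  exact (Finset.card_union_le _ _).trans
    (Nat.add_le_add Finset.card_image_le Finset.card_image_le)

theorem Program.CircuitReducesTo.of_transducer {IA IB : Type} {A : Program EA IA}
    {B : Program EB IB} [Countable Q] (Δ : Finset (Q × Option EA × EB × Q)) (q₀ q₁ : Q)
    (hΔ : IsDetermined Δ)
    (hAB : ∀ x ∈ A.grammar.language, ∃ y ∈ B.grammar.language, Run Δ q₀ x y q₁)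
    (hBA : ∀ x y, y ∈ B.grammar.language → Run Δ q₀ x y q₁ → x ∈ A.grammar.language) :
    Program.CircuitReducesTo.{u} A B (3 * Δ.card) := by
  classical
  intro V I s t
  -- States are coded by natural numbers because the new constants must live in `Type`, whatever the
  -- universe of `Q`.
  obtain ⟨ι, hι⟩ := exists_injective_nat Q
  -- Silent transitions must be available at `s` even if `s` occurs in no fact; this accounts for
  -- the `+ 1` in the bounds.
  set D : Finset V := insert s (activeDomain_finite I).toFinset with hD
  have hID : activeDomain I ⊆ D := fun a ha => by simp [hD, ha]
  have hcard : D.card ≤ (activeDomain I).ncard + 1 := by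
    rw [Set.ncard_eq_toFinset_card _ (activeDomain_finite I)]
    exact Finset.card_insert_le _ _
  have hn := ncard_activeDomain_le I
  refine ⟨V × ℕ, productInput ι Δ I D, (s, ι q₀), (t, ι q₁), ?_, ?_, fun F' =>
    ⟨F'.subst (readFact ι Δ I D), le_rfl, (Circuit.depthAt_subst _ F' _ _).le, ?_⟩⟩
  · refine card_productInput_le.trans ?_
    rw [mul_comm 3, mul_assoc]
    -- Here `|I| + |D| ≤ |I| + (2|I| + 1) ≤ 3(|I| + 1)`.
    exact Nat.mul_le_mul_left _ (by omega)
  · refine (ncard_activeDomain_productInput_le hID).trans ?_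
    exact Nat.mul_le_mul (Nat.mul_le_mul_right _ (by norm_num)) hcard
  · intro S _ hS hF'
    refine Circuit.Computes.subst hS _ ?_ ?_ hF'
    · intro p hp hw
      obtain ⟨y, hy, hr⟩ := hAB _ hw
      obtain ⟨p', h1, rfl, h3⟩ := hr.exists_isWalk hι hΔ hID (by simp [hD]) hp rfl
      exact ⟨p', h1, hy, h3⟩
    · intro p' hp' hw
      obtain ⟨h1, h2⟩ := hp'.exists_run hι hΔ
      exact ⟨h1, hBA _ _ hw h2⟩

end Product

/-! ### Words derived by chain programs -/

theorem Program.ne_nil_of_derives {EDB : Type v} {IDB : Type} {P : Program EDB IDB}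
    {x y : List (Symbol EDB IDB)} (h : P.grammar.Derives x y) (hx : x ≠ []) : y ≠ [] := by
  induction h with
  | refl => exact hx
  | tail _ hyz ih =>
    obtain ⟨r', hr', hw⟩ := hyz
    obtain ⟨r, hr, rfl⟩ := Finset.mem_map.1 hr'
    obtain ⟨p, q, rfl, rfl⟩ := hw.exists_parts
    intro h
    exact r.body_ne_nil (List.append_eq_nil_iff.1 (List.append_eq_nil_iff.1 h).1).2

theorem Program.ne_nil_of_mem_language {EDB : Type v} {IDB : Type} {P : Program EDB IDB}
    {x : List EDB} (h : x ∈ P.grammar.language) : x ≠ [] := by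
  rintro rfl
  exact Program.ne_nil_of_derives (P := P) h (List.cons_ne_nil _ _) rfl

/-- As a target, this language only asks that a run write something; as a source, only that it read
something. -/
theorem mem_language_transitiveClosure {x : List Unit} :
    x ∈ transitiveClosure.grammar.language ↔ x ≠ [] := by
  refine ⟨Program.ne_nil_of_mem_language, fun hx => ?_⟩
  change transitiveClosure.grammar.Derives [Symbol.nonterminal ()] (x.map Symbol.terminal)
  induction x using List.reverseRecOn with
  | nil => exact absurd rfl hx
  | append_singleton x e ih =>
    have h₁ : (⟨(), [Symbol.terminal ()], by simp⟩ : ChainRule Unit Unit) ∈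
        transitiveClosure.rules := by simp [transitiveClosure]
    have h₂ : (⟨(), [Symbol.nonterminal (), Symbol.terminal ()], by simp⟩ : ChainRule Unit Unit) ∈
        transitiveClosure.rules := by simp [transitiveClosure]
    rcases eq_or_ne x [] with rfl | hx
    · exact ContextFreeGrammar.Produces.single
        ⟨_, Finset.mem_map_of_mem _ h₁, ContextFreeRule.Rewrites.input_output⟩
    · refine ContextFreeGrammar.Produces.trans_derives
        ⟨_, Finset.mem_map_of_mem _ h₂, ContextFreeRule.Rewrites.input_output⟩ ?_
      rw [List.map_append]
      exact (ih hx).append_right [Symbol.terminal ()]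

/-! ### Regular programs reduce to transitive closure -/

section Automaton

variable {EDB : Type v} [Finite EDB] {σ : Type} [Finite σ] (M : DFA EDB σ)

/-- The transducer that reads the words accepted by `M`: it remembers the letter read last, and
proceeds from accepting states to a sink. -/
noncomputable def acceptorTransducer :
    Finset (Option (σ × Option EDB) × Option EDB × Unit × Option (σ × Option EDB)) :=
  (Set.toFinite {d | (∃ q o R, d = (some (q, o), some R, (), some (M.step q R, some R))) ∨
    ∃ q o, q ∈ M.accept ∧ d = (some (q, o), none, (), none)}).toFinset

variable {M}

theorem mem_acceptorTransducer
    {d : Option (σ × Option EDB) × Option EDB × Unit × Option (σ × Option EDB)} :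
    d ∈ acceptorTransducer M ↔
      (∃ q o R, d = (some (q, o), some R, (), some (M.step q R, some R))) ∨
        ∃ q o, q ∈ M.accept ∧ d = (some (q, o), none, (), none) :=
  Set.Finite.mem_toFinset _

/-- Every transition writes `()`, so the letter read has to be visible in the target state: it is
stored there, and the sink is entered only silently. -/
theorem isDetermined_acceptorTransducer : IsDetermined (acceptorTransducer M) := by
  intro q o o' B q' h h'
  rcases mem_acceptorTransducer.1 h with ⟨p, r, R, h⟩ | ⟨p, r, -, h⟩ <;>
  rcases mem_acceptorTransducer.1 h' with ⟨p', r', R', h'⟩ | ⟨p', r', -, h'⟩ <;>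
  simp only [Prod.mk.injEq] at h h' <;> grind

theorem exists_run_acceptorTransducer (x : List EDB) (q : σ) (o : Option EDB)
    (h : M.evalFrom q x ∈ M.accept) :
    ∃ y, y ≠ [] ∧ Run (acceptorTransducer M) (some (q, o)) x y none := by
  induction x generalizing q o with
  | nil =>
    exact ⟨[()], by simp, .stay (mem_acceptorTransducer.2 (Or.inr ⟨q, o, h, rfl⟩)) (.nil _)⟩
  | cons R x ih =>
    obtain ⟨y, -, hy⟩ := ih (M.step q R) (some R) h
    exact ⟨() :: y, by simp, .move (mem_acceptorTransducer.2 (Or.inl ⟨q, o, R, rfl⟩)) hy⟩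

/-- The statement is an invariant of the source state. No transition leaves the sink, and it is
entered only from accepting states, so the word ends exactly there. -/
theorem Run.evalFrom_mem_accept {s s' : Option (σ × Option EDB)} {x : List EDB} {y : List Unit}
    (h : Run (acceptorTransducer M) s x y s') (hs' : s' = none) :
    match s with
    | none => x = []
    | some (q, _) => M.evalFrom q x ∈ M.accept := by
  induction h with
  | nil => subst hs'; rfl
  | @move s₁ s₂ s₃ A B x y hd _ ih =>
    have ih' := ih hs'
    rcases mem_acceptorTransducer.1 hd with ⟨q, o, R, h⟩ | ⟨q, o, -, h⟩
    · simp only [Prod.mk.injEq, Option.some.injEq] at h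
      obtain ⟨h1, rfl, -, h2⟩ := h
      subst h1 h2
      exact ih'
    · simp at h
  | @stay s₁ s₂ s₃ B x y hd _ ih =>
    have ih' := ih hs'
    rcases mem_acceptorTransducer.1 hd with ⟨q, o, R, h⟩ | ⟨q, o, hq, h⟩
    · simp at h
    · simp only [Prod.mk.injEq] at h
      obtain ⟨h1, -, -, h2⟩ := h
      subst h1 h2
      have hx : x = [] := ih'
      subst hx
      exact hq

theorem Program.CircuitReducesTo.transitiveClosure_of_isRegular {IDB : Type}
    {P : Program EDB IDB} (h : P.grammar.language.IsRegular) :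
    ∃ c, Program.CircuitReducesTo.{u} P transitiveClosure c := by
  obtain ⟨σ, _, M, hM⟩ := h
  refine ⟨_, .of_transducer (acceptorTransducer M) (some (M.start, none)) none
    isDetermined_acceptorTransducer ?_ ?_⟩
  · intro x hx
    rw [← hM] at hx
    obtain ⟨y, hy, hr⟩ := exists_run_acceptorTransducer x M.start none hx
    exact ⟨y, mem_language_transitiveClosure.2 hy, hr⟩
  · intro x y _ hr
    rw [← hM]
    exact hr.evalFrom_mem_accept rfl

end Automaton

/-! ### Transitive closure reduces to programs with a pumpable word -/

section Pumping

variable {EDB : Type v} (x : List EDB) (R : EDB) (y z : List EDB)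

open Classical in
/-- The transducer that writes the words `x (R y)ⁿ z`, reading a letter whenever it writes the
first letter of a repetition. Its states are the suffixes of `x R y z` that remain to be written. -/
noncomputable def pumpTransducer : Finset (List EDB × Option Unit × EDB × List EDB) :=
  insert (z, some (), R, y ++ z)
    ((x ++ R :: (y ++ z)).tails.filterMap fun
      | [] => none
      | B :: l => some (B :: l, if l = y ++ z then some () else none, B, l)).toFinset

variable {x R y z}

theorem mem_pumpTransducer {d : List EDB × Option Unit × EDB × List EDB} :
    d ∈ pumpTransducer x R y z ↔ d = (z, some (), R, y ++ z) ∨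
      ∃ B l, (B :: l) <:+ x ++ R :: (y ++ z) ∧
        ((l = y ++ z ∧ d = (B :: l, some (), B, l)) ∨ (l ≠ y ++ z ∧ d = (B :: l, none, B, l))) := by
  classical
  simp only [pumpTransducer, Finset.mem_insert, List.mem_toFinset, List.mem_filterMap,
    List.mem_tails]
  refine or_congr_right ?_
  constructor
  · rintro ⟨_ | ⟨B, l⟩, hs, h⟩
    · simp at h
    · refine ⟨B, l, hs, ?_⟩
      by_cases hl : l = y ++ z
      · exact Or.inl ⟨hl, by simpa [hl] using h.symm⟩
      · exact Or.inr ⟨hl, by simpa [hl] using h.symm⟩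
  · rintro ⟨B, l, hs, ⟨hl, rfl⟩ | ⟨hl, rfl⟩⟩
    · exact ⟨B :: l, hs, by simp [hl]⟩
    · exact ⟨B :: l, hs, by simp [hl]⟩

/-- A letter is read exactly when the target state is `y ++ z`, both on the first `R` and on the
return from `z`. -/
theorem isDetermined_pumpTransducer : IsDetermined (pumpTransducer x R y z) := by
  have key : ∀ q o B q', (q, o, B, q') ∈ pumpTransducer x R y z →
      (q' = y ++ z ∧ o = some ()) ∨ (q' ≠ y ++ z ∧ o = none) := by
    intro q o B q' h
    rcases mem_pumpTransducer.1 h with h | ⟨B, l, -, ⟨hl, h⟩ | ⟨hl, h⟩⟩ <;>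
      simp only [Prod.mk.injEq] at h <;> grind
  intro q o o' B q' h h'
  have := key _ _ _ _ h
  have := key _ _ _ _ h'
  grind

/-- By `h`, the states entered are all longer or all strictly shorter than `y ++ z`, so no step
reads a letter. -/
theorem run_pumpTransducer_silent (p l : List EDB) (hs : (p ++ l) <:+ x ++ R :: (y ++ z))
    (h : (y ++ z).length < l.length ∨ (p ++ l).length ≤ (y ++ z).length) :
    Run (pumpTransducer x R y z) (p ++ l) [] p l := by
  induction p with
  | nil => exact .nil _
  | cons B p ih =>
    have hne : p ++ l ≠ y ++ z := by
      intro he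
      have := congrArg List.length he
      simp only [List.length_append, List.length_cons] at this h
      omega
    refine .stay (mem_pumpTransducer.2 (Or.inr ⟨B, p ++ l, hs, Or.inr ⟨hne, rfl⟩⟩))
      (ih ((List.suffix_cons B _).trans hs) ?_)
    simp only [List.length_append, List.length_cons] at h ⊢
    omega

theorem run_pumpTransducer_inner : Run (pumpTransducer x R y z) (y ++ z) [] y z :=
  run_pumpTransducer_silent _ _ ⟨x ++ [R], by simp⟩ (Or.inr le_rfl)

theorem run_pumpTransducer_loop (a : List Unit) :
    Run (pumpTransducer x R y z) z a (List.replicate a.length (R :: y)).flatten z := by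
  induction a with
  | nil => exact .nil _
  | cons _ a ih =>
    have := run_pumpTransducer_inner (x := x) (R := R) (y := y) (z := z)
    exact .move (mem_pumpTransducer.2 (Or.inl rfl)) (this.append ih)

/-- The first letter is read on the `R` that follows `x`, each later one on the return transition
from `z`; `x`, the copies of `y` and the final `z` are written silently. -/
theorem run_pumpTransducer {a : List Unit} (ha : a ≠ []) :
    Run (pumpTransducer x R y z) (x ++ R :: (y ++ z)) a
      (x ++ (List.replicate a.length (R :: y)).flatten ++ z) [] := by
  obtain ⟨_, a, rfl⟩ := List.exists_cons_of_ne_nil ha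
  have h1 : Run (pumpTransducer x R y z) (x ++ R :: (y ++ z)) [] x (R :: (y ++ z)) :=
    run_pumpTransducer_silent _ _ (List.suffix_refl _) (Or.inl (by simp))
  have h2 := (run_pumpTransducer_inner (x := x) (R := R) (y := y) (z := z)).append
    (run_pumpTransducer_loop a)
  have h3 : Run (pumpTransducer x R y z) (R :: (y ++ z)) (() :: a)
      (R :: (y ++ (List.replicate a.length (R :: y)).flatten)) z :=
    .move (mem_pumpTransducer.2 (Or.inr ⟨R, y ++ z, List.suffix_append _ _, Or.inl ⟨rfl, rfl⟩⟩)) h2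
  have h4 : Run (pumpTransducer x R y z) z [] z [] := by
    have := run_pumpTransducer_silent (x := x) (R := R) (y := y) (z := z) z []
      ⟨x ++ R :: y, by simp⟩ (Or.inr (by simp))
    rwa [List.append_nil] at this
  simpa [List.replicate_succ] using (h1.append h3).append h4

/-- Silent steps remove one letter at a time and never enter `y ++ z`, so they cannot get past it.
Thus a run from the initial state to `[]` reads at least one letter. -/
theorem Run.length_lt_of_silent {q q' : List EDB} {a : List Unit} {b : List EDB}
    (h : Run (pumpTransducer x R y z) q a b q') (ha : a = [])
    (hq : (y ++ z).length < q.length) : (y ++ z).length < q'.length := by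
  induction h with
  | nil => exact hq
  | move => simp at ha
  | stay hd _ ih =>
    refine ih ha ?_
    rcases mem_pumpTransducer.1 hd with h | ⟨B, l, hs, ⟨hl, h⟩ | ⟨hl, h⟩⟩
    · simp at h
    · simp at h
    · simp only [Prod.mk.injEq] at h
      obtain ⟨rfl, -, -, rfl⟩ := h
      rw [List.length_cons] at hq
      -- A suffix is determined by its length, so reaching the length of `y ++ z` would mean
      -- reaching `y ++ z` itself.
      refine lt_of_le_of_ne (Nat.lt_succ_iff.1 hq) fun he => hl ?_
      have h1 := (List.suffix_cons B _).trans hs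
      have h2 : (y ++ z) <:+ x ++ R :: (y ++ z) := ⟨x ++ [R], by simp⟩
      exact ((List.suffix_of_suffix_length_le h2 h1 he.le).eq_of_length he).symm

theorem Program.CircuitReducesTo.of_transitiveClosure {IDB : Type} [Finite EDB]
    {P : Program EDB IDB} (hreg : P.grammar.language.IsRegular)
    (hinf : (P.grammar.language : Set (List EDB)).Infinite) :
    ∃ c, Program.CircuitReducesTo.{u} transitiveClosure P c := by
  obtain ⟨σ, _, M, hM⟩ := hreg
  -- Over a finite alphabet only finitely many words are shorter than the number of states.
  obtain ⟨a, ha, hlen⟩ : ∃ a ∈ P.grammar.language, Fintype.card σ ≤ a.length := by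
    by_contra! h
    exact hinf ((List.finite_length_lt EDB (Fintype.card σ)).subset h)
  rw [← hM] at ha
  obtain ⟨x, Ry, z, -, -, hne, hsub⟩ := M.pumping_lemma ha hlen
  obtain ⟨R, y, rfl⟩ := List.exists_cons_of_ne_nil hne
  rw [hM] at hsub
  refine ⟨_, .of_transducer (pumpTransducer x R y z) (x ++ R :: (y ++ z)) []
    isDetermined_pumpTransducer ?_ ?_⟩
  · intro a ha
    refine ⟨_, hsub ?_, run_pumpTransducer (mem_language_transitiveClosure.1 ha)⟩
    refine Language.append_mem_mul (Language.append_mem_mul rfl ?_) rfl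
    exact Language.mem_kstar.2 ⟨_, rfl, fun b hb => (List.eq_of_mem_replicate hb)⟩
  · intro a b _ hr
    refine mem_language_transitiveClosure.2 fun h => ?_
    -- The initial state is longer than `y ++ z`, whereas the final state `[]` is not.
    have := hr.length_lt_of_silent h (by simp; omega)
    simp at this

end Pumping

end ChainDatalog

theorem mainTheorem6 {EDB : Type v} {IDB : Type} [Finite EDB]
    (P : ChainDatalog.Program EDB IDB)
    (hreg : P.grammar.language.IsRegular)
    (hinf : (P.grammar.language : Set (List EDB)).Infinite) :
    ∃ c : ℕ,
      ChainDatalog.Program.CircuitReducesTo.{u} ChainDatalog.transitiveClosure P c ∧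
      ChainDatalog.Program.CircuitReducesTo.{u} P ChainDatalog.transitiveClosure c ∧
      ∀ (S : Type u) [CommSemiring S], ChainDatalog.IsAbsorptive S → ∀ m n : ℕ,
        ChainDatalog.transitiveClosure.sizeComplexity S m n ≤
          P.sizeComplexity S (c * (m + 1)) (c * (n + 1)) ∧
        ChainDatalog.transitiveClosure.depthComplexity S m n ≤
          P.depthComplexity S (c * (m + 1)) (c * (n + 1)) ∧
        P.sizeComplexity S m n ≤
          ChainDatalog.transitiveClosure.sizeComplexity S (c * (m + 1)) (c * (n + 1)) ∧
        P.depthComplexity S m n ≤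
          ChainDatalog.transitiveClosure.depthComplexity S (c * (m + 1)) (c * (n + 1)) := by
  obtain ⟨c₁, h₁⟩ :=
    ChainDatalog.Program.CircuitReducesTo.of_transitiveClosure.{u} hreg hinf
  obtain ⟨c₂, h₂⟩ :=
    ChainDatalog.Program.CircuitReducesTo.transitiveClosure_of_isRegular.{u} hreg
  have h₁ := h₁.mono (le_max_left c₁ c₂)
  have h₂ := h₂.mono (le_max_right c₁ c₂)
  exact ⟨max c₁ c₂, h₁, h₂, fun S _ hS m n =>
    ⟨h₁.sizeComplexity_le S hS m n, h₁.depthComplexity_le S hS m n,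
      h₂.sizeComplexity_le S hS m n, h₂.depthComplexity_le S hS m n⟩⟩
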